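/- For integers $s,t\ge 3$ and $p\ge 0$, let the Rose tree $\mathcal R(s,t,p)$ be the graph obtained from a path with $s+t+1$ vertices $1,\dots,s+t+1$ and a star consisting of a center $c$ and $p$ leaves, by adding an edge between the vertex $s+1$ of the path and the center $c$. A Fiedler vector of a connected graph is an eigenvector of its Laplacian matrix $L=D-A$ for the smallest nonzero eigenvalue. A graph whose Fiedler vector $\Phi$ is unique up to a scalar multiple satisfies (FED) if exactly two vertices are extrema of $\Phi$ (that is, the global minimum of $\Phi$ is attained at exactly one vertex $m$ and the global maximum at exactly one vertex $M$), and the distance between $m$ and $M$ equals the diameter of the graph. **Theorem.** For all integers $s,t\ge 3$ and $p\ge 0$, the tree $\mathcal R(s,t,p)$ has a Fiedler vector that is unique up to a nonzero scalar multiple. Moreover there are functions $f_m,f_M:\{3,4,5,\dots\}^2\to\mathbb R$ with $f_m\ge 1$ such that, for all $s,t\ge 3$ and all integers $p\ge 0$, 1. if $p\le f_m(s,t)$, then $\mathcal R(s,t,p)$ satisfies (FED); 2. if $p>f_M(s,t)$, then $\mathcal R(s,t,p)$ does not satisfy (FED). The thresholds are sharp: (FED) fails for $p=\lfloor f_m(s,t)\rfloor+1$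 and holds for $p=\lfloor f_M(s,t)\rfloor$. -/

import Mathlib

/-- `μ` is the first nonzero (that is, the smallest positive) eigenvalue of the Laplacian matrix
`L = D - A` of `G`. The Laplacian is positive semidefinite and, when `G` is connected, `0` is a
simple eigenvalue of it, so that `μ` is then the second smallest eigenvalue: the algebraic
connectivity of `G`. -/
def IsFirstNonzeroLaplacianEigenvalue {V : Type*} [Fintype V] [DecidableEq V]
    (G : SimpleGraph V) [DecidableRel G.Adj] (μ : ℝ) : Prop :=
  IsLeast {l : ℝ | 0 < l ∧ Module.End.HasEigenvalue (Matrix.toLin' (G.lapMatrix ℝ)) l} μ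

/-- A Fiedler vector of `G`: an eigenvector (nonzero by definition) of the Laplacian for its first
nonzero eigenvalue. -/
def IsFiedlerVector {V : Type*} [Fintype V] [DecidableEq V]
    (G : SimpleGraph V) [DecidableRel G.Adj] (Φ : V → ℝ) : Prop :=
  ∃ μ : ℝ, IsFirstNonzeroLaplacianEigenvalue G μ ∧
    Module.End.HasEigenvector (Matrix.toLin' (G.lapMatrix ℝ)) μ Φ

/-- `G` has a Fiedler vector, and it is unique up to a (nonzero) multiplicative constant. -/
def HasUniqueFiedlerVector {V : Type*} [Fintype V] [DecidableEq V]
    (G : SimpleGraph V) [DecidableRel G.Adj] : Prop :=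
  ∃ Φ : V → ℝ, IsFiedlerVector G Φ ∧
    ∀ Ψ : V → ℝ, IsFiedlerVector G Ψ → ∃ c : ℝ, c ≠ 0 ∧ Ψ = c • Φ

/-- `Φ` attains its (global) minimum at `v`. -/
def AttainsMinAt {V : Type*} (Φ : V → ℝ) (v : V) : Prop := ∀ w, Φ v ≤ Φ w

/-- `Φ` attains its (global) maximum at `v`. -/
def AttainsMaxAt {V : Type*} (Φ : V → ℝ) (v : V) : Prop := ∀ w, Φ w ≤ Φ v

/-- Property (FED), for a graph whose Fiedler vector `Φ` is unique up to a multiplicative constant: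
`Φ` has exactly two extrema (vertices at which it attains its minimum or its maximum), and the
distance between the vertex `m` at which it is minimal and the vertex `M` at which it is maximal
equals the diameter of `G`. The property does not depend on the multiple of `Φ` that is used. -/
def FED {V : Type*} [Fintype V] [DecidableEq V]
    (G : SimpleGraph V) [DecidableRel G.Adj] : Prop :=
  ∀ Φ : V → ℝ, IsFiedlerVector G Φ →
    {v : V | AttainsMinAt Φ v ∨ AttainsMaxAt Φ v}.ncard = 2 ∧
      ∀ m M : V, AttainsMinAt Φ m → AttainsMaxAt Φ M → G.dist m M = G.diam

/-- The vertices of the Rose tree: the `s + t + 1` vertices of the path (numbered from `0`), and the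
vertices of the star, namely its center `none` and its `p` leaves `some i`. -/
abbrev RoseVertex (s t p : ℕ) : Type := Fin (s + t + 1) ⊕ Option (Fin p)

/-- The Rose tree `R(s,t,p)`: the disjoint union of a path with `s + t + 1` vertices and of a star
with `p` branches, together with an edge joining the `(s+1)`-st vertex of the path to the center of
the star. -/
def roseTree (s t p : ℕ) : SimpleGraph (RoseVertex s t p) :=
  (SimpleGraph.pathGraph (s + t + 1) ⊕g SimpleGraph.starGraph (none : Option (Fin p))) ⊔
    SimpleGraph.edge (Sum.inl ⟨s, by omega⟩) (Sum.inr none)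

noncomputable instance (s t p : ℕ) : DecidableRel (roseTree s t p).Adj :=
  Classical.decRel _

/-! The first nonzero eigenvalue of `R(s,t,p)` is at most that of its path with `s + t + 1`
vertices: extend the path eigenvector by a constant to the star and subtract the mean. It is
therefore `μ = 2 - 2 cos θ` with `0 < (s + t + 1) θ ≤ π` (`exists_angle`). On each arm the eigenvalue
equation is a three-term recurrence, so that an eigenvector is `a cos ((j + 1/2) θ)` on one arm,
`b cos ((j + 1/2) θ)` on the other (`j` being the distance from the end), and constant, equal to `y`,
on the leaves of the star (`RoseProfile`). With `A = (s + 1/2) θ`, `B = (t + 1/2) θ` and the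
*star factor* `K = (1 - μ) ^ 2 - p μ`, the value at the branching vertex is
`a cos A = b cos B = K y`, and the equation there, multiplied by this value, reads
`(K y) ^ 2 = sin θ * a b * sin (A + B) + (1 - μ) K y ^ 2`, where `0 < A + B ≤ π`
(`RoseProfile.sq_branch`).

*Uniqueness.* An eigenvector that vanishes at the end of the longer arm is zero, unless
`A = B = π / 2` and `K = 0`. Then `s = t` and `2 - 2 cos (π / (2 s + 1))` would solve
`(1 - μ) ^ 2 = p μ`; this is excluded by the degree `φ(2 s + 1) ≥ 6` of the cyclotomic polynomial
(`star_factor_ne_zero`).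

*At most one leaf.* Here `0 < K < 1 - μ`, so the branch equation forces `a b < 0`. The eigenvector is
strictly monotone along each arm, and the star is a shorter arm, whose values stay strictly between
those at the two ends (`RoseProfile.strict_extrema`). The ends are the only two vertices at the
distance `s + t`, which is the diameter (`roseTree_dist_lt`).

*Many leaves.* If (FED) holds, the extrema are the ends of the path, so `a b < 0`, and one of the
arms carries a zero of the cosine. This bounds `μ` below independently of `p`, so `K < 0` for large
`p`. Then both terms on the right of the branch equation are nonpositive, and the eigenvector
vanishes at the branching vertex. In that case a multiple of one arm, combined with the vector on the
star that is `1 - μ` at the center and `1` at the leaves, has a Rayleigh quotient smaller than `μ`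
(`star_factor_nonneg`).

So (FED) holds for `p ≤ 1` and fails for all large `p`, and the thresholds are the predecessor of the
first failure and the last success (`exists_thresholds`). -/

/-! ### The first nonzero Laplacian eigenvalue of a graph -/

open Matrix in
/-- The Laplacian as a sum of differences over neighbours. -/
lemma SimpleGraph.lapMatrix_mulVec_eq_sum {V : Type*} [Fintype V] [DecidableEq V]
    (G : SimpleGraph V) [DecidableRel G.Adj] (f : V → ℝ) (v : V) :
    (G.lapMatrix ℝ *ᵥ f) v = ∑ w, if G.Adj v w then f v - f w else 0 := by
  rw [SimpleGraph.lapMatrix_mulVec_apply, ← Finset.sum_filter, Finset.sum_sub_distrib,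
    Finset.sum_const, nsmul_eq_mul, ← SimpleGraph.card_neighborFinset_eq_degree,
    SimpleGraph.neighborFinset_eq_filter]

open Matrix in
lemma hasEigenvalue_iff_exists_mulVec {V : Type*} [Fintype V] [DecidableEq V]
    (G : SimpleGraph V) [DecidableRel G.Adj] (l : ℝ) :
    Module.End.HasEigenvalue (Matrix.toLin' (G.lapMatrix ℝ)) l ↔
      ∃ f : V → ℝ, f ≠ 0 ∧ G.lapMatrix ℝ *ᵥ f = l • f := by
  constructor
  · intro h
    obtain ⟨f, hf⟩ := h.exists_hasEigenvector
    exact ⟨f, hf.2, by simpa using hf.apply_eq_smul⟩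
  · rintro ⟨f, hf, h⟩
    exact Module.End.hasEigenvalue_of_hasEigenvector
      (Module.End.hasEigenvector_iff.2 ⟨Module.End.mem_eigenspace_iff.2 (by simpa using h), hf⟩)

open Matrix in
/-- Spectral decomposition of the quadratic form of the Laplacian. -/
lemma exists_spectral_decomposition {V : Type*} [Fintype V] [DecidableEq V]
    (G : SimpleGraph V) [DecidableRel G.Adj] (f : V → ℝ) :
    ∃ (l : V → ℝ) (u : V → V → ℝ), (∀ i, 0 ≤ l i) ∧ (∀ i, u i ≠ 0) ∧
      (∀ i, G.lapMatrix ℝ *ᵥ u i = l i • u i) ∧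
      f ⬝ᵥ f = ∑ i, (u i ⬝ᵥ f) ^ 2 ∧
      f ⬝ᵥ (G.lapMatrix ℝ *ᵥ f) = ∑ i, l i * (u i ⬝ᵥ f) ^ 2 := by
  have hP := SimpleGraph.posSemidef_lapMatrix ℝ G
  set b := hP.1.eigenvectorBasis with hb
  have hmul : ∀ i, G.lapMatrix ℝ *ᵥ (b i).ofLp = hP.1.eigenvalues i • (b i).ofLp :=
    fun i => hP.1.mulVec_eigenvectorBasis i
  have key : ∀ g : V → ℝ, f ⬝ᵥ g = ∑ i, ((b i).ofLp ⬝ᵥ f) * ((b i).ofLp ⬝ᵥ g) := by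
    intro g
    have := b.sum_inner_mul_inner (WithLp.toLp 2 f) (WithLp.toLp 2 g)
    simp only [EuclideanSpace.inner_eq_star_dotProduct, star_trivial] at this
    rw [dotProduct_comm f g, ← this]
    exact Finset.sum_congr rfl fun i _ => by rw [dotProduct_comm g]
  refine ⟨hP.1.eigenvalues, fun i => (b i).ofLp, hP.eigenvalues_nonneg, ?_, hmul, ?_, ?_⟩
  · intro i h
    have h1 := b.orthonormal.ne_zero i
    exact h1 (by ext v; simpa using congrFun h v)
  · rw [key]; exact Finset.sum_congr rfl fun i _ => (sq _).symm
  · rw [key]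
    refine Finset.sum_congr rfl fun i _ => ?_
    have h2 : (b i).ofLp ⬝ᵥ (G.lapMatrix ℝ *ᵥ f) = hP.1.eigenvalues i * ((b i).ofLp ⬝ᵥ f) := by
      rw [dotProduct_mulVec, ← mulVec_transpose, (SimpleGraph.isSymm_lapMatrix ℝ G).eq, hmul,
        smul_dotProduct, smul_eq_mul]
    rw [h2]; ring

open Matrix in
/-- Courant–Fischer bound for the first nonzero eigenvalue of a connected graph. -/
lemma IsFirstNonzeroLaplacianEigenvalue.mul_dotProduct_le {V : Type*} [Fintype V] [DecidableEq V]
    {G : SimpleGraph V} [DecidableRel G.Adj] (hG : G.Connected) {μ : ℝ}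
    (hμ : IsFirstNonzeroLaplacianEigenvalue G μ) (f : V → ℝ) (hf : ∑ v, f v = 0) :
    μ * (f ⬝ᵥ f) ≤ f ⬝ᵥ (G.lapMatrix ℝ *ᵥ f) := by
  obtain ⟨l, u, hl, hu, hlu, h1, h2⟩ := exists_spectral_decomposition G f
  rw [h1, h2, Finset.mul_sum]
  refine Finset.sum_le_sum fun i _ => ?_
  rcases (hl i).eq_or_lt with h0 | h0
  · -- a kernel vector is constant, hence orthogonal to `f`
    have hk : G.lapMatrix ℝ *ᵥ u i = 0 := by rw [hlu, ← h0, zero_smul]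
    rw [SimpleGraph.lapMatrix_mulVec_eq_zero_iff_forall_reachable] at hk
    obtain ⟨v₀⟩ := hG.nonempty
    have : u i ⬝ᵥ f = 0 := by
      have : u i = fun _ => u i v₀ := funext fun v => hk _ _ (hG.preconnected v v₀)
      rw [this, dotProduct, ← Finset.mul_sum, hf, mul_zero]
    simp [this]
  · have : μ ≤ l i := hμ.2 ⟨h0, (hasEigenvalue_iff_exists_mulVec G _).2 ⟨u i, hu i, hlu i⟩⟩
    gcongr

open Matrix in
/-- Removing the mean of an arbitrary test vector in the Courant–Fischer bound. -/
lemma IsFirstNonzeroLaplacianEigenvalue.mul_sub_mean_le {V : Type*} [Fintype V] [DecidableEq V]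
    {G : SimpleGraph V} [DecidableRel G.Adj] (hG : G.Connected) {μ : ℝ}
    (hμ : IsFirstNonzeroLaplacianEigenvalue G μ) (f : V → ℝ) (m : ℝ)
    (hm : ∑ v, (f v - m) = 0) :
    μ * ∑ v, (f v - m) ^ 2 ≤ f ⬝ᵥ (G.lapMatrix ℝ *ᵥ f) := by
  have h := hμ.mul_dotProduct_le hG (fun v => f v - m) hm
  have h1 : (fun v => f v - m) ⬝ᵥ (fun v => f v - m) = ∑ v, (f v - m) ^ 2 :=
    Finset.sum_congr rfl fun v _ => (sq _).symm
  have hc : G.lapMatrix ℝ *ᵥ (fun _ => m) = 0 := by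
    rw [SimpleGraph.lapMatrix_mulVec_eq_zero_iff_forall_adj]; intros; rfl
  have h2 : (fun v => f v - m) = f - fun _ => m := rfl
  have h3 : (fun _ => m) ⬝ᵥ (G.lapMatrix ℝ *ᵥ f) = 0 := by
    rw [dotProduct_mulVec, ← mulVec_transpose, (SimpleGraph.isSymm_lapMatrix ℝ G).eq, hc,
      zero_dotProduct]
  rw [h1] at h
  rw [h2, mulVec_sub, hc, sub_zero, sub_dotProduct, h3, sub_zero] at h
  exact h

open Matrix in
lemma sum_eq_zero_of_lapMatrix_mulVec_eq_smul {V : Type*} [Fintype V] [DecidableEq V]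
    (G : SimpleGraph V) [DecidableRel G.Adj] {μ : ℝ} (hμ : μ ≠ 0) {f : V → ℝ}
    (hf : G.lapMatrix ℝ *ᵥ f = μ • f) : ∑ v, f v = 0 := by
  have hc : G.lapMatrix ℝ *ᵥ (fun _ => (1 : ℝ)) = 0 := by
    rw [SimpleGraph.lapMatrix_mulVec_eq_zero_iff_forall_adj]; intros; rfl
  have h3 : (fun _ => (1 : ℝ)) ⬝ᵥ (G.lapMatrix ℝ *ᵥ f) = 0 := by
    rw [dotProduct_mulVec, ← mulVec_transpose, (SimpleGraph.isSymm_lapMatrix ℝ G).eq, hc,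
      zero_dotProduct]
  rw [hf, dotProduct_smul, smul_eq_mul, mul_eq_zero, or_iff_right hμ] at h3
  simpa [dotProduct] using h3

open Matrix in
lemma exists_isFirstNonzeroLaplacianEigenvalue {V : Type*} [Fintype V] [DecidableEq V]
    (G : SimpleGraph V) [DecidableRel G.Adj] {v w : V} (hvw : G.Adj v w) :
    ∃ μ, IsFirstNonzeroLaplacianEigenvalue G μ := by
  have hfin : {l : ℝ | 0 < l ∧
      Module.End.HasEigenvalue (Matrix.toLin' (G.lapMatrix ℝ)) l}.Finite :=
    (Module.End.finite_hasEigenvalue _).subset fun l hl => hl.2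
  have hne : {l : ℝ | 0 < l ∧
      Module.End.HasEigenvalue (Matrix.toLin' (G.lapMatrix ℝ)) l}.Nonempty := by
    by_contra hcon
    rw [Set.not_nonempty_iff_eq_empty, Set.eq_empty_iff_forall_notMem] at hcon
    obtain ⟨l, u, hl, hu, hlu, -, h2⟩ := exists_spectral_decomposition G (Pi.single v 1)
    have hz : ∀ i, l i = 0 := fun i => by
      by_contra h
      exact hcon (l i) ⟨lt_of_le_of_ne (hl i) (Ne.symm h),
        (hasEigenvalue_iff_exists_mulVec G _).2 ⟨u i, hu i, hlu i⟩⟩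
    simp only [hz, zero_mul, Finset.sum_const_zero] at h2
    have h3 := (SimpleGraph.posSemidef_lapMatrix ℝ G).dotProduct_mulVec_zero_iff (Pi.single v 1)
    rw [star_trivial] at h3
    have h4 := (SimpleGraph.lapMatrix_mulVec_eq_zero_iff_forall_adj G).1 (h3.1 h2) v w hvw
    simp [hvw.ne'] at h4
  exact ⟨_, hne.csInf_mem hfin, fun x hx => csInf_le hfin.bddBelow hx⟩

/-! ### Adjacency and distances in the Rose tree -/

section Adjacency
variable {s t p : ℕ}

lemma roseTree_adj_inl_inl {i j : Fin (s + t + 1)} :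
    (roseTree s t p).Adj (.inl i) (.inl j) ↔ (i : ℕ) + 1 = j ∨ (j : ℕ) + 1 = i := by
  simp [roseTree, SimpleGraph.edge_adj, SimpleGraph.pathGraph_adj]

lemma roseTree_adj_inl_none {i : Fin (s + t + 1)} :
    (roseTree s t p).Adj (.inl i) (.inr none) ↔ (i : ℕ) = s := by
  simp [roseTree, SimpleGraph.edge_adj, Fin.ext_iff]

lemma roseTree_not_adj_inl_some {i : Fin (s + t + 1)} {k : Fin p} :
    ¬ (roseTree s t p).Adj (.inl i) (.inr (some k)) := by
  simp [roseTree, SimpleGraph.edge_adj]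

lemma roseTree_adj_none_some {k : Fin p} :
    (roseTree s t p).Adj (.inr none) (.inr (some k)) := by
  simp [roseTree]

lemma roseTree_not_adj_some_some {k l : Fin p} :
    ¬ (roseTree s t p).Adj (.inr (some k)) (.inr (some l)) := by
  simp [roseTree, SimpleGraph.edge_adj]

end Adjacency

section Distance
variable {s t : ℕ} (p : ℕ)

lemma roseTree_exists_walk_path (i d : ℕ) (h : i + d < s + t + 1) :
    ∃ w : (roseTree s t p).Walk (.inl ⟨i, by omega⟩) (.inl ⟨i + d, h⟩), w.length = d := by
  induction d with
  | zero => exact ⟨.nil, rfl⟩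
  | succ d ih =>
    obtain ⟨w, hw⟩ := ih (by omega)
    exact ⟨w.concat (roseTree_adj_inl_inl.2 (.inl rfl)), by simp [hw]⟩

lemma roseTree_exists_walk_inl (i j : Fin (s + t + 1)) :
    ∃ w : (roseTree s t p).Walk (.inl i) (.inl j), w.length = ((i : ℕ) - j) + (j - i) := by
  obtain ⟨i, hi⟩ := i
  obtain ⟨j, hj⟩ := j
  rcases le_total i j with hij | hij
  · obtain ⟨d, rfl⟩ := Nat.exists_eq_add_of_le hij
    obtain ⟨w, hw⟩ := roseTree_exists_walk_path p i d hj
    exact ⟨w, by simp [hw]⟩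
  · obtain ⟨d, rfl⟩ := Nat.exists_eq_add_of_le hij
    obtain ⟨w, hw⟩ := roseTree_exists_walk_path p j d hi
    exact ⟨w.reverse, by simp [hw]⟩

lemma roseTree_exists_walk_inr (v : Option (Fin p)) :
    ∃ w : (roseTree s t p).Walk (.inr v) (.inl ⟨s, by omega⟩), w.length ≤ 2 := by
  have h0 : (roseTree s t p).Adj (.inr none) (.inl ⟨s, by omega⟩) :=
    (roseTree_adj_inl_none.2 rfl).symm
  rcases v with _ | k
  · exact ⟨h0.toWalk, by simp⟩
  · exact ⟨.cons roseTree_adj_none_some.symm h0.toWalk, by simp⟩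

lemma roseTree_connected : (roseTree s t p).Connected := by
  have h : ∀ v : RoseVertex s t p, (roseTree s t p).Reachable v (.inl ⟨s, by omega⟩) := by
    rintro (i | v)
    · exact (roseTree_exists_walk_inl p i _).choose.reachable
    · exact (roseTree_exists_walk_inr p v).choose.reachable
  exact ⟨fun u v => (h u).trans (h v).symm⟩

/-- Going along an edge changes the position of the projection to the path by at most one. -/
lemma roseTree_proj_le_length {u v : RoseVertex s t p} (w : (roseTree s t p).Walk u v) :
    Sum.elim (fun i : Fin (s + t + 1) => (i : ℕ)) (fun _ => s) v ≤
      Sum.elim (fun i : Fin (s + t + 1) => (i : ℕ)) (fun _ => s) u + w.length := by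
  induction w with
  | nil => simp
  | @cons a b c hab w ih =>
    refine ih.trans ?_
    rw [SimpleGraph.Walk.length_cons]
    rcases a with i | _ | k <;> rcases b with j | _ | l <;> simp only [Sum.elim_inl, Sum.elim_inr]
    · rw [roseTree_adj_inl_inl] at hab; omega
    · rw [roseTree_adj_inl_none] at hab; omega
    · exact absurd hab roseTree_not_adj_inl_some
    · have := roseTree_adj_inl_none.1 hab.symm; omega
    · omega
    · omega
    · exact absurd hab.symm roseTree_not_adj_inl_some
    · omega
    · omega

lemma roseTree_dist_ends :
    (roseTree s t p).dist (.inl ⟨0, by omega⟩) (.inl ⟨s + t, by omega⟩) = s + t := by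
  apply le_antisymm
  · obtain ⟨w, hw⟩ := roseTree_exists_walk_inl (s := s) (t := t) p ⟨0, by omega⟩
      ⟨s + t, by omega⟩
    exact (SimpleGraph.dist_le w).trans (by rw [hw]; simp)
  · obtain ⟨w, hw⟩ := (roseTree_connected (s := s) (t := t) p).exists_walk_length_eq_dist
      (.inl ⟨0, by omega⟩) (.inl ⟨s + t, by omega⟩)
    have := roseTree_proj_le_length p w
    simp only [Sum.elim_inl] at this
    omega

/-- For arms of length at least `3`, two vertices that are not the two ends of the path are closer
to each other than these two ends: a path through the star leaves it at depth at most `2`. -/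
lemma roseTree_dist_lt (hs : 3 ≤ s) (ht : 3 ≤ t) (u v : RoseVertex s t p)
    (h : ¬ (u = .inl ⟨0, by omega⟩ ∧ v = .inl ⟨s + t, by omega⟩ ∨
      u = .inl ⟨s + t, by omega⟩ ∧ v = .inl ⟨0, by omega⟩)) :
    (roseTree s t p).dist u v < s + t := by
  have tri := (roseTree_connected (s := s) (t := t) p).dist_triangle (u := u)
    (v := .inl ⟨s, by omega⟩) (w := v)
  have hin : ∀ i j, (roseTree s t p).dist (.inl i) (.inl j) ≤ ((i : ℕ) - j) + (j - i) := by
    intro i j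
    obtain ⟨w, hw⟩ := roseTree_exists_walk_inl p i j
    exact hw ▸ SimpleGraph.dist_le w
  have hout : ∀ v, (roseTree s t p).dist (.inr v) (.inl ⟨s, by omega⟩) ≤ 2 := by
    intro v
    obtain ⟨w, hw⟩ := roseTree_exists_walk_inr p v
    exact (SimpleGraph.dist_le w).trans hw
  rcases u with i | u <;> rcases v with j | v
  · have := hin i j
    simp only [Sum.inl.injEq, Fin.ext_iff] at h
    omega
  · have h1 := hin i ⟨s, by omega⟩
    have h2 := hout v
    rw [SimpleGraph.dist_comm] at h2
    simp only at h1
    omega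
  · have h1 := hin ⟨s, by omega⟩ j
    have h2 := hout u
    simp only at h1
    omega
  · have h1 := hout u
    have h2 := hout v
    rw [SimpleGraph.dist_comm] at h2
    omega

lemma roseTree_diam (hs : 3 ≤ s) (ht : 3 ≤ t) : (roseTree s t p).diam = s + t := by
  apply le_antisymm
  · have : Nonempty (RoseVertex s t p) := ⟨.inr none⟩
    obtain ⟨u, v, huv⟩ := (roseTree s t p).exists_dist_eq_diam
    rw [← huv]
    by_contra hlt
    have := roseTree_dist_lt p hs ht u v
    rcases not_not.1 (mt this (by omega)) with ⟨rfl, rfl⟩ | ⟨rfl, rfl⟩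
    · rw [roseTree_dist_ends] at hlt; omega
    · rw [SimpleGraph.dist_comm, roseTree_dist_ends] at hlt; omega
  · have : Nonempty (RoseVertex s t p) := ⟨.inr none⟩
    have h := SimpleGraph.dist_le_diam
      (SimpleGraph.connected_iff_ediam_ne_top.1 (roseTree_connected (s := s) (t := t) p))
      (u := .inl ⟨0, by omega⟩) (v := .inl ⟨s + t, by omega⟩)
    rwa [roseTree_dist_ends] at h

end Distance

/-! ### The Laplacian of the Rose tree -/

section Laplacian
variable {s t p : ℕ}
open Matrix

lemma sum_fin_path_neighbours (n j : ℕ) (hj : j < n) (x : ℕ → ℝ) :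
    ∑ k : Fin n, (if j + 1 = (k : ℕ) ∨ (k : ℕ) + 1 = j then x j - x k else 0) =
      (if 0 < j then x j - x (j - 1) else 0) + (if j + 1 < n then x j - x (j + 1) else 0) := by
  have h : ∀ k : ℕ, (if j + 1 = k ∨ k + 1 = j then x j - x k else 0) =
      (if k = j - 1 then (if 0 < j then x j - x (j - 1) else 0) else 0) +
      (if k = j + 1 then x j - x (j + 1) else 0) := by
    intro k
    by_cases h1 : k = j + 1
    · subst h1; simp; omega
    · by_cases h2 : k + 1 = j
      · subst h2; simp; omega
      · rw [if_neg (by omega), if_neg h1]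
        by_cases h3 : 0 < j
        · rw [if_neg (by omega)]; simp
        · simp [h3]
  rw [Fin.sum_univ_eq_sum_range (fun k => if j + 1 = k ∨ k + 1 = j then x j - x k else 0) n]
  simp only [h, Finset.sum_add_distrib, Finset.sum_ite_eq', Finset.mem_range]
  rw [if_pos (by omega)]

/-- The Laplacian of the Rose tree at a vertex of the path. -/
lemma roseTree_lapMatrix_inl (f : RoseVertex s t p → ℝ) (x : ℕ → ℝ)
    (hx : ∀ j : Fin (s + t + 1), f (.inl j) = x j) (j : Fin (s + t + 1)) :
    ((roseTree s t p).lapMatrix ℝ *ᵥ f) (.inl j) =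
      (if 0 < (j : ℕ) then x j - x (j - 1) else 0) +
      (if (j : ℕ) + 1 < s + t + 1 then x j - x (j + 1) else 0) +
      (if (j : ℕ) = s then x j - f (.inr none) else 0) := by
  rw [SimpleGraph.lapMatrix_mulVec_eq_sum, Fintype.sum_sum_type, Fintype.sum_option]
  simp only [roseTree_adj_inl_inl, roseTree_adj_inl_none, roseTree_not_adj_inl_some, hx, if_false,
    Finset.sum_const_zero, add_zero]
  rw [sum_fin_path_neighbours _ _ j.2]

/-- The Laplacian of the Rose tree at the center of the star. -/
lemma roseTree_lapMatrix_center (f : RoseVertex s t p → ℝ) :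
    ((roseTree s t p).lapMatrix ℝ *ᵥ f) (.inr none) =
      (f (.inr none) - f (.inl ⟨s, by omega⟩)) + ∑ k, (f (.inr none) - f (.inr (some k))) := by
  rw [SimpleGraph.lapMatrix_mulVec_eq_sum, Fintype.sum_sum_type, Fintype.sum_option]
  simp only [(roseTree s t p).adj_comm (.inr none) (.inl _), roseTree_adj_inl_none,
    roseTree_adj_none_some, SimpleGraph.irrefl, if_true, if_false, zero_add]
  congr 1
  rw [Finset.sum_eq_single (⟨s, by omega⟩ : Fin (s + t + 1))]
  · simp
  · intro b _ hb
    rw [if_neg fun h => hb (Fin.ext h)]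
  · simp

/-- The Laplacian of the Rose tree at a leaf of the star. -/
lemma roseTree_lapMatrix_leaf (f : RoseVertex s t p → ℝ) (k : Fin p) :
    ((roseTree s t p).lapMatrix ℝ *ᵥ f) (.inr (some k)) = f (.inr (some k)) - f (.inr none) := by
  rw [SimpleGraph.lapMatrix_mulVec_eq_sum, Fintype.sum_sum_type, Fintype.sum_option]
  simp [(roseTree s t p).adj_comm (.inr (some k)), roseTree_not_adj_inl_some,
    roseTree_adj_none_some, roseTree_not_adj_some_some]

end Laplacian

open Matrix Real

/-! ### Eigenvectors of the Rose tree -/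

/-- A solution of the eigenvalue equation along a path that starts at a leaf is a multiple of
`cos ((j + 1/2) θ)`. -/
lemma mul_cos_half_of_recurrence {x : ℕ → ℝ} {θ : ℝ} {m : ℕ} (h0 : x 1 = (2 * cos θ - 1) * x 0)
    (h : ∀ j, j + 2 ≤ m → x (j + 2) = 2 * cos θ * x (j + 1) - x j) :
    ∀ j, j ≤ m → x j * cos (θ / 2) = x 0 * cos ((j + 1 / 2) * θ) := by
  have hc : ∀ y : ℝ, cos (y + θ) = 2 * cos θ * cos y - cos (y - θ) := fun y => by
    rw [cos_add, cos_sub]; ring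
  intro j
  induction j using Nat.twoStepInduction with
  | zero => intro _; congr 2; push_cast; ring
  | one =>
    intro _
    have e1 : ((1 : ℕ) + 1 / 2 : ℝ) * θ = θ / 2 + θ := by push_cast; ring
    have e2 : θ / 2 - θ = -(θ / 2) := by ring
    rw [e1, hc, e2, cos_neg, h0]; ring
  | more j ih1 ih2 =>
    intro hj
    have e1 : ((j + 2 : ℕ) + 1 / 2 : ℝ) * θ = ((j + 1 : ℕ) + 1 / 2 : ℝ) * θ + θ := by
      push_cast; ring
    have e2 : ((j + 1 : ℕ) + 1 / 2 : ℝ) * θ - θ = (j + 1 / 2 : ℝ) * θ := by push_cast; ring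
    rw [e1, hc, e2, h j hj, sub_mul, mul_assoc, ih2 (by omega), ih1 (by omega)]; ring

/-- The shape of an eigenvector of the Rose tree for the eigenvalue `2 - 2 cos θ`: a cosine of
amplitude `a` on the arm of length `s`, a cosine of amplitude `b` on the arm of length `t` (both
measured from the end of the arm), and the value `y` at the leaves of the star. When `p = 0` the
number `y` is determined by the value at the center. The last two fields are the equations at the
center of the star and at the branching vertex. -/
structure RoseProfile (s t p : ℕ) (θ : ℝ) (f : RoseVertex s t p → ℝ) (a b y : ℝ) : Prop where
  left : ∀ j : ℕ, ∀ h : j < s + t + 1, j ≤ s → f (.inl ⟨j, h⟩) = a * cos ((j + 1 / 2) * θ)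
  right : ∀ j : ℕ, ∀ h : j ≤ t,
    f (.inl ⟨s + t - j, by omega⟩) = b * cos ((j + 1 / 2) * θ)
  center : f (.inr none) = (1 - (2 - 2 * cos θ)) * y
  leaf : ∀ k, f (.inr (some k)) = y
  star : f (.inl ⟨s, by omega⟩) = ((1 - (2 - 2 * cos θ)) ^ 2 - p * (2 - 2 * cos θ)) * y
  branch : f (.inl ⟨s, by omega⟩) =
    sin θ * (a * sin ((s + 1 / 2) * θ) + b * sin ((t + 1 / 2) * θ)) + (1 - (2 - 2 * cos θ)) * y

/-- The first eigenvalues considered are small, since the path has at least seven vertices. -/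
lemma eigenvalue_lt_of_mul_le_pi {s t : ℕ} (hs : 3 ≤ s) (ht : 3 ≤ t) {θ : ℝ} (h0 : 0 < θ)
    (hθ : (s + t + 1) * θ ≤ π) : 0 < 2 - 2 * cos θ ∧ 2 - 2 * cos θ < 1 / 4 ∧ θ < π / 4 := by
  have hs' : (3 : ℝ) ≤ s := by exact_mod_cast hs
  have ht' : (3 : ℝ) ≤ t := by exact_mod_cast ht
  have h7 : 7 * θ ≤ π := le_trans (by gcongr; linarith) hθ
  have hpi := pi_lt_d2
  refine ⟨?_, ?_, by linarith [pi_pos]⟩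
  · have : cos θ < cos 0 := cos_lt_cos_of_nonneg_of_le_pi le_rfl (by linarith) h0
    rw [cos_zero] at this; linarith
  · have := one_sub_sq_div_two_le_cos (x := θ)
    nlinarith

lemma exists_roseProfile {s t p : ℕ} (hs : 3 ≤ s) (ht : 3 ≤ t) {θ : ℝ} (h0 : 0 < θ)
    (hθ : (s + t + 1) * θ ≤ π) {f : RoseVertex s t p → ℝ}
    (hf : (roseTree s t p).lapMatrix ℝ *ᵥ f = (2 - 2 * cos θ) • f) :
    ∃ a b y, RoseProfile s t p θ f a b y := by
  obtain ⟨hμ0, hμ1, hθ4⟩ := eigenvalue_lt_of_mul_le_pi hs ht h0 hθ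
  have hc : 0 < cos (θ / 2) := cos_pos_of_mem_Ioo ⟨by linarith [pi_pos], by linarith [pi_pos]⟩
  set x : ℕ → ℝ := fun j => if h : j < s + t + 1 then f (.inl ⟨j, h⟩) else 0 with hxdef
  have hx : ∀ j (h : j < s + t + 1), f (.inl ⟨j, h⟩) = x j := fun j h => by
    simp only [hxdef]; rw [dif_pos h]
  have heq : ∀ v, ((roseTree s t p).lapMatrix ℝ *ᵥ f) v = (2 - 2 * cos θ) * f v := fun v => by
    rw [hf]; rfl
  have hpath : ∀ j, j < s + t + 1 → (if 0 < j then x j - x (j - 1) else 0) +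
      (if j + 1 < s + t + 1 then x j - x (j + 1) else 0) +
      (if j = s then x j - f (.inr none) else 0) = (2 - 2 * cos θ) * x j := fun j h => by
    have := heq (.inl ⟨j, h⟩)
    rw [roseTree_lapMatrix_inl f x (fun j => hx j j.2)] at this
    rw [← hx j h]; simpa [← hx j h] using this
  have hL := mul_cos_half_of_recurrence (x := x) (θ := θ) (m := s)
    (by have := hpath 0 (by omega)
        rw [if_neg (by omega), if_pos (by omega), if_neg (by omega)] at this
        simp only [zero_add] at this; linarith)
    (fun j hj => by
      have := hpath (j + 1) (by omega)
      rw [if_pos (by omega), if_pos (by omega), if_neg (by omega)] at this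
      simp only [Nat.add_sub_cancel] at this
      linarith)
  have hR := mul_cos_half_of_recurrence (x := fun j => x (s + t - j)) (θ := θ) (m := t)
    (by have := hpath (s + t) (by omega)
        rw [if_pos (by omega), if_neg (by omega), if_neg (by omega)] at this
        simp only [Nat.sub_zero]; linarith)
    (fun j hj => by
      have := hpath (s + t - (j + 1)) (by omega)
      rw [if_pos (by omega), if_pos (by omega), if_neg (by omega)] at this
      have e1 : s + t - (j + 1) - 1 = s + t - (j + 2) := by omega
      have e2 : s + t - (j + 1) + 1 = s + t - j := by omega
      rw [e1, e2] at this
      linarith)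
  have hL' : ∀ j, j ≤ s → x j = x 0 / cos (θ / 2) * cos ((j + 1 / 2) * θ) := fun j hj => by
    rw [div_mul_eq_mul_div, eq_div_iff hc.ne', hL j hj]
  have hR' : ∀ j, j ≤ t → x (s + t - j) =
      x (s + t) / cos (θ / 2) * cos ((j + 1 / 2) * θ) := fun j hj => by
    rw [div_mul_eq_mul_div, eq_div_iff hc.ne']; simpa using hR j hj
  have hμ : 1 - (2 - 2 * cos θ) ≠ 0 := by linarith
  have hcen : f (.inr none) = (1 - (2 - 2 * cos θ)) * (f (.inr none) / (1 - (2 - 2 * cos θ))) := by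
    rw [← mul_div_assoc, mul_div_cancel_left₀ _ hμ]
  have hleaf : ∀ k, f (.inr (some k)) = f (.inr none) / (1 - (2 - 2 * cos θ)) := fun k => by
    have := heq (.inr (some k))
    rw [roseTree_lapMatrix_leaf] at this
    rw [eq_div_iff hμ]; linarith
  refine ⟨x 0 / cos (θ / 2), x (s + t) / cos (θ / 2), f (.inr none) / (1 - (2 - 2 * cos θ)),
    fun j h hj => by rw [hx, hL' j hj], fun j h => by rw [hx, hR' j h], hcen, hleaf, ?_, ?_⟩
  · have := heq (.inr none)
    rw [roseTree_lapMatrix_center] at this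
    simp only [hleaf, Finset.sum_const, Finset.card_univ, Fintype.card_fin, nsmul_eq_mul] at this
    set y := f (.inr none) / (1 - (2 - 2 * cos θ))
    rw [hcen] at this
    linear_combination -this
  · have h1 := hpath s (by omega)
    rw [if_pos (by omega), if_pos (by omega), if_pos rfl] at h1
    have hA := hL' s le_rfl
    have hA' := hL' (s - 1) (by omega)
    have hB := hR' t le_rfl
    have hB' := hR' (t - 1) (by omega)
    have e1 : s + t - t = s := by omega
    have e2 : s + t - (t - 1) = s + 1 := by omega
    have e3 : ((s - 1 : ℕ) + 1 / 2 : ℝ) * θ = (s + 1 / 2) * θ - θ := by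
      rw [Nat.cast_sub (by omega)]; push_cast; ring
    have e4 : ((t - 1 : ℕ) + 1 / 2 : ℝ) * θ = (t + 1 / 2) * θ - θ := by
      rw [Nat.cast_sub (by omega)]; push_cast; ring
    rw [e1] at hB
    rw [e2, e4, cos_sub] at hB'
    rw [e3, cos_sub] at hA'
    rw [← hcen, hx]
    linear_combination h1 + hA' + hB' - cos θ * hA - cos θ * hB

/-! ### The bound on the first eigenvalue -/

/-- The first nonzero eigenvalue is `2 - 2 cos θ` for an angle `θ ≤ π / (s + t + 1)`: the cosine of
the long path, extended by a constant to the star, shows that attaching a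
star to the path does not increase the first nonzero eigenvalue. -/
lemma exists_angle {s t p : ℕ} (hs : 3 ≤ s) {μ : ℝ}
    (hμ : IsFirstNonzeroLaplacianEigenvalue (roseTree s t p) μ) :
    ∃ θ, 0 < θ ∧ (s + t + 1) * θ ≤ π ∧ μ = 2 - 2 * cos θ := by
  set n : ℕ := s + t + 1 with hn
  have hn0 : (0 : ℝ) < n := by rw [hn]; positivity
  set θ₀ : ℝ := π / n with hθ₀
  have hnθ : n * θ₀ = π := by rw [hθ₀]; field_simp
  have hθpos : 0 < θ₀ := by positivity
  set x : ℕ → ℝ := fun j => cos ((j + 1 / 2) * θ₀) with hx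
  set f : RoseVertex s t p → ℝ := Sum.elim (fun i => x i) (fun _ => x s) with hf
  have hodd : ∀ j, j < n → x (n - 1 - j) = - x j := fun j hj => by
    simp only [hx]
    rw [← cos_pi_sub, Nat.cast_sub (by omega), Nat.cast_sub (by omega), ← hnθ]
    congr 1; push_cast; ring
  have hsum : ∑ j : Fin n, x j = 0 := by
    have h1 : ∑ j : Fin n, x j = ∑ j : Fin n, - x j := by
      rw [← Equiv.sum_comp Fin.revPerm]
      refine Finset.sum_congr rfl fun j _ => ?_
      rw [← hodd j j.2]
      congr 1
      simp only [Fin.revPerm_apply, Fin.val_rev]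
      omega
    rw [Finset.sum_neg_distrib] at h1
    linarith
  have hrec : ∀ j : ℕ, 2 * x (j + 1) - x j - x (j + 2) = (2 - 2 * cos θ₀) * x (j + 1) := fun j => by
    simp only [hx]
    have e1 : (j + 1 / 2 : ℝ) * θ₀ = ((j + 1 : ℕ) + 1 / 2 : ℝ) * θ₀ - θ₀ := by push_cast; ring
    have e2 : ((j + 2 : ℕ) + 1 / 2 : ℝ) * θ₀ = ((j + 1 : ℕ) + 1 / 2 : ℝ) * θ₀ + θ₀ := by
      push_cast; ring
    rw [e1, e2, cos_sub, cos_add]; ring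
  have hstart : x 0 - x 1 = (2 - 2 * cos θ₀) * x 0 := by
    simp only [hx]
    have e1 : ((0 : ℕ) + 1 / 2 : ℝ) * θ₀ = -(((0 : ℕ) + 1 / 2 : ℝ) * θ₀ - θ₀) := by
      push_cast; ring
    have e2 : ((1 : ℕ) + 1 / 2 : ℝ) * θ₀ = ((0 : ℕ) + 1 / 2 : ℝ) * θ₀ + θ₀ := by
      push_cast; ring
    have e3 : cos (((0 : ℕ) + 1 / 2 : ℝ) * θ₀) = cos (((0 : ℕ) + 1 / 2 : ℝ) * θ₀ - θ₀) := by
      rw [e1, cos_neg, ← e1]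
    rw [cos_sub] at e3
    rw [e2, cos_add]; linear_combination -e3
  have hLpath : ∀ j : Fin n, ((roseTree s t p).lapMatrix ℝ *ᵥ f) (.inl j) =
      (2 - 2 * cos θ₀) * x j := by
    intro j
    rw [roseTree_lapMatrix_inl f x (fun _ => rfl)]
    have e0 : (if (j : ℕ) = s then x j - f (.inr none) else 0) = 0 := by
      split_ifs with h
      · simp [hf, h]
      · rfl
    rw [e0, add_zero]
    obtain ⟨j, hj⟩ := j
    simp only
    rcases j with _ | j
    · rw [if_neg (lt_irrefl _), zero_add, ← hstart]
      rw [if_pos (by omega)]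
    · rw [if_pos (by omega)]
      split_ifs with h
      · rw [← hrec]; simp only [Nat.add_sub_cancel]; ring
      · have h3 : x (j + 2) = x (j + 1) := by
          simp only [hx]
          have hjn : (n : ℝ) = j + 2 := by
            have : n = j + 2 := by omega
            rw [this]; push_cast; ring
          rw [hjn] at hnθ
          have e4 : ((j + 2 : ℕ) + 1 / 2 : ℝ) * θ₀ = θ₀ / 2 + π := by
            rw [← hnθ]; push_cast; ring
          have e5 : ((j + 1 : ℕ) + 1 / 2 : ℝ) * θ₀ = π - θ₀ / 2 := by
            rw [← hnθ]; push_cast; ring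
          rw [e4, e5, cos_add_pi, cos_pi_sub]
        rw [← hrec, h3]; simp only [Nat.add_sub_cancel]; ring
  have hLstar : ∀ v, ((roseTree s t p).lapMatrix ℝ *ᵥ f) (.inr v) = 0 := by
    rintro (_ | k)
    · rw [roseTree_lapMatrix_center]; simp [hf]
    · rw [roseTree_lapMatrix_leaf]; simp [hf]
  have hform : f ⬝ᵥ ((roseTree s t p).lapMatrix ℝ *ᵥ f) =
      (2 - 2 * cos θ₀) * ∑ j : Fin n, x j ^ 2 := by
    rw [dotProduct, Fintype.sum_sum_type]
    simp only [hLpath, hLstar, mul_zero, Finset.sum_const_zero, add_zero, Finset.mul_sum]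
    exact Finset.sum_congr rfl fun j _ => by simp only [hf, Sum.elim_inl]; ring
  set m : ℝ := (∑ v, f v) / Fintype.card (RoseVertex s t p) with hm
  have hm0 : ∑ v, (f v - m) = 0 := by
    have : Nonempty (RoseVertex s t p) := ⟨.inr none⟩
    rw [Finset.sum_sub_distrib, Finset.sum_const, Finset.card_univ, nsmul_eq_mul, hm,
      mul_div_cancel₀ _ (by exact_mod_cast Fintype.card_ne_zero), sub_self]
  have hmain := hμ.mul_sub_mean_le (roseTree_connected p) f m hm0
  have hge : ∑ j : Fin n, x j ^ 2 ≤ ∑ v, (f v - m) ^ 2 := by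
    rw [Fintype.sum_sum_type]
    have h1 : ∑ j : Fin n, (f (.inl j) - m) ^ 2 = ∑ j : Fin n, x j ^ 2 + n * m ^ 2 := by
      have : ∀ j : Fin n, (f (.inl j) - m) ^ 2 = x j ^ 2 - 2 * m * x j + m ^ 2 := fun j => by
        simp only [hf, Sum.elim_inl]; ring
      simp only [this, Finset.sum_add_distrib, Finset.sum_sub_distrib, ← Finset.mul_sum, hsum]
      simp
    have h2 : 0 ≤ ∑ v, (f (.inr v) - m) ^ 2 := Finset.sum_nonneg fun _ _ => sq_nonneg _
    have h3 : 0 ≤ n * m ^ 2 := by positivity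
    linarith
  have hpos : 0 < ∑ j : Fin n, x j ^ 2 := by
    have h2 : 2 * θ₀ ≤ π := by
      rw [← hnθ]; gcongr; exact_mod_cast (by omega : 2 ≤ n)
    have hx0 : 0 < x 0 := by
      refine cos_pos_of_mem_Ioo ⟨?_, ?_⟩ <;> push_cast <;> linarith [pi_pos]
    exact Finset.sum_pos' (fun _ _ => sq_nonneg _)
      ⟨⟨0, by omega⟩, Finset.mem_univ _, by positivity⟩
  have hle : μ ≤ 2 - 2 * cos θ₀ := by
    rw [hform] at hmain
    exact le_of_mul_le_mul_right ((mul_le_mul_of_nonneg_left hge hμ.1.1.le).trans hmain) hpos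
  have hμ0 := hμ.1.1
  have hcos := neg_one_le_cos θ₀
  refine ⟨arccos (1 - μ / 2), arccos_pos.2 (by linarith), ?_, ?_⟩
  · have h1 : arccos (1 - μ / 2) ≤ arccos (cos θ₀) := arccos_le_arccos (by linarith)
    rw [arccos_cos hθpos.le (div_le_self pi_pos.le (by exact_mod_cast (by omega : 1 ≤ n)))] at h1
    calc ((s : ℝ) + t + 1) * arccos (1 - μ / 2) = n * arccos (1 - μ / 2) := by
          rw [hn]; push_cast; ring
      _ ≤ n * θ₀ := by gcongr
      _ = π := hnθ
  · rw [cos_arccos (by linarith) (by linarith)]; ring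

/-! ### The star factor does not vanish in the symmetric case -/

lemma six_le_totient_of_odd {n : ℕ} (hn : 7 ≤ n) (hodd : Odd n) : 6 ≤ n.totient := by
  have hsub : ({1, 2, 4, n - 1, n - 2, n - 4} : Finset ℕ) ⊆
      (Finset.range n).filter n.Coprime := by
    have h2 : n.Coprime 2 := hodd.coprime_two_right
    have h4 : n.Coprime 4 := h2.pow_right 2
    have hsubc : ∀ k ≤ n, n.Coprime k → n.Coprime (n - k) := fun k hk h => by
      rwa [Nat.coprime_self_sub_right hk]
    intro k hk
    simp only [Finset.mem_insert, Finset.mem_singleton] at hk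
    rw [Finset.mem_filter, Finset.mem_range]
    rcases hk with rfl | rfl | rfl | rfl | rfl | rfl
    · exact ⟨by omega, Nat.coprime_one_right n⟩
    · exact ⟨by omega, h2⟩
    · exact ⟨by omega, h4⟩
    · exact ⟨by omega, hsubc 1 (by omega) (Nat.coprime_one_right n)⟩
    · exact ⟨by omega, hsubc 2 (by omega) h2⟩
    · exact ⟨by omega, hsubc 4 (by omega) h4⟩
  have hcard : ({1, 2, 4, n - 1, n - 2, n - 4} : Finset ℕ).card = 6 := by
    obtain ⟨k, rfl⟩ := hodd
    repeat rw [Finset.card_insert_of_notMem (by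
      simp only [Finset.mem_insert, Finset.mem_singleton]; omega)]
    rfl
  rw [Nat.totient, ← hcard]
  exact Finset.card_le_card hsub

open Polynomial in
/-- If `θ = π / (2 s + 1)`, then `-exp (i θ)` is a primitive root of unity of order `2 s + 1 ≥ 7`, of
degree at least `6`, so that `2 - 2 cos θ` solves no equation `(1 - μ) ^ 2 = p μ` (which would be of
degree `4` in `-exp (i θ)`). For `s = 2` and `p = 1` the equation does hold. -/
lemma star_factor_ne_zero {s : ℕ} (hs : 3 ≤ s) (p : ℕ) {θ : ℝ} (hθ : (2 * s + 1) * θ = π) :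
    (1 - (2 - 2 * cos θ)) ^ 2 - p * (2 - 2 * cos θ) ≠ 0 := by
  intro h
  set e : ℂ := Complex.exp (θ * Complex.I) with he
  have he0 : e ≠ 0 := Complex.exp_ne_zero _
  have hprim : IsPrimitiveRoot (-e) (2 * s + 1) := by
    have h1 := Complex.isPrimitiveRoot_exp_of_coprime (s + 1) (2 * s + 1) (by omega) (by
      rw [show 2 * s + 1 = s + (s + 1) by ring]; simp)
    convert h1 using 1
    have hs0 : ((2 : ℂ) * s + 1) ≠ 0 := by exact_mod_cast (by omega : 2 * s + 1 ≠ 0)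
    have hθc : (2 * (s : ℂ) + 1) * θ = π := by exact_mod_cast hθ
    have h2 : 2 * (π : ℂ) * Complex.I * ((s + 1 : ℕ) / (2 * s + 1 : ℕ)) =
        θ * Complex.I + π * Complex.I := by
      push_cast
      rw [← hθc]; field_simp; ring
    rw [h2, Complex.exp_add, Complex.exp_pi_mul_I, he]; ring
  have hcos : 2 * (cos θ : ℂ) * e = e ^ 2 + 1 := by
    have h3 := Complex.two_cos (θ : ℂ)
    rw [neg_mul, Complex.exp_neg, ← he] at h3
    rw [Complex.ofReal_cos, h3]; field_simp
  have hc : (1 - (2 - 2 * (cos θ : ℂ))) ^ 2 - p * (2 - 2 * (cos θ : ℂ)) = 0 := by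
    exact_mod_cast h
  set P : ℤ[X] := (X ^ 2 + X + 1) ^ 2 - (p : ℤ[X]) * X * (X + 1) ^ 2 with hP
  have hroot : aeval (-e) P = 0 := by
    simp only [hP, map_sub, map_mul, map_pow, map_add, aeval_X, map_one, map_natCast]
    have h4 : ((2 * (cos θ : ℂ) * e - e) ^ 2 - p * e * (2 * e - 2 * (cos θ : ℂ) * e)) = 0 := by
      linear_combination e ^ 2 * hc
    rw [hcos] at h4
    linear_combination h4
  have hdeg : P.natDegree ≤ 4 := by rw [hP]; compute_degree
  have hcoef : P.coeff 0 = 1 := by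
    rw [coeff_zero_eq_eval_zero]; simp [hP]
  have hP0 : P ≠ 0 := fun h0 => by simp [h0] at hcoef
  have h5 := natDegree_le_of_dvd
    (minpoly.isIntegrallyClosed_dvd (hprim.isIntegral (by omega)) hroot) hP0
  have h6 := hprim.totient_le_degree_minpoly
  have h7 := six_le_totient_of_odd (n := 2 * s + 1) (by omega) ⟨s, rfl⟩
  omega

/-! ### Uniqueness of the Fiedler vector -/

namespace RoseProfile
variable {s t p : ℕ} {θ a b y : ℝ} {f : RoseVertex s t p → ℝ}

lemma left_eq (h : RoseProfile s t p θ f a b y) :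
    f (.inl ⟨s, by omega⟩) = a * cos ((s + 1 / 2) * θ) := h.left s (by omega) le_rfl

lemma right_eq (h : RoseProfile s t p θ f a b y) :
    f (.inl ⟨s, by omega⟩) = b * cos ((t + 1 / 2) * θ) := by
  rw [← h.right t le_rfl]; congr 2; ext; simp

lemma left_end (h : RoseProfile s t p θ f a b y) :
    f (.inl ⟨0, by omega⟩) = a * cos (θ / 2) := by
  rw [h.left 0 (by omega) (by omega)]; congr 2; push_cast; ring

lemma right_end (h : RoseProfile s t p θ f a b y) :
    f (.inl ⟨s + t, by omega⟩) = b * cos (θ / 2) := by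
  have := h.right 0 (by omega)
  rw [show ((0 : ℕ) + 1 / 2 : ℝ) * θ = θ / 2 by push_cast; ring] at this
  exact this

lemma eq_zero (h : RoseProfile s t p θ f 0 0 0) : f = 0 := by
  funext v
  rcases v with ⟨j, hj⟩ | _ | k
  · rcases le_total j s with hjs | hjs
    · rw [h.left j hj hjs]; simp
    · obtain ⟨d, rfl⟩ := Nat.exists_eq_add_of_le hjs
      have h1 := h.right (t - d) (by omega)
      rw [zero_mul] at h1
      have e : s + t - (t - d) = s + d := by omega
      simp only [e] at h1
      exact h1
  · rw [h.center]; simp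
  · rw [h.leaf]; simp

lemma neg (h : RoseProfile s t p θ f a b y) : RoseProfile s t p θ (-f) (-a) (-b) (-y) where
  left j hj hjs := by rw [Pi.neg_apply, h.left j hj hjs]; ring
  right j hj := by rw [Pi.neg_apply, h.right j hj]; ring
  center := by rw [Pi.neg_apply, h.center]; ring
  leaf k := by rw [Pi.neg_apply, h.leaf]
  star := by rw [Pi.neg_apply, h.star]; ring
  branch := by rw [Pi.neg_apply, h.branch]; ring

/-- The equation at the branching vertex, multiplied by the value there. -/
lemma sq_branch (h : RoseProfile s t p θ f a b y) :
    f (.inl ⟨s, by omega⟩) ^ 2 = sin θ * (a * b) * sin ((s + t + 1) * θ) +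
      (1 - (2 - 2 * cos θ)) * ((1 - (2 - 2 * cos θ)) ^ 2 - p * (2 - 2 * cos θ)) * y ^ 2 := by
  have hA := h.left_eq
  have hB := h.right_eq
  have hK := h.star
  have hS := h.branch
  have e : (s + t + 1 : ℝ) * θ = (s + 1 / 2) * θ + (t + 1 / 2) * θ := by ring
  rw [e, sin_add]
  set v := f (.inl ⟨s, by omega⟩)
  set μ := 2 - 2 * cos θ
  linear_combination v * hS + sin θ * a * sin ((s + 1 / 2) * θ) * hB +
    sin θ * b * sin ((t + 1 / 2) * θ) * hA + (1 - μ) * y * hK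

end RoseProfile

/-- The equations that remain when one amplitude vanishes, on the longer of the two arms, force the
rest of the profile to vanish. -/
lemma amplitudes_eq_zero {s t p : ℕ} (hs : 3 ≤ s) (hts : t ≤ s) {θ b y : ℝ} (h0 : 0 < θ)
    (hθ : (s + t + 1) * θ ≤ π) (hsin : 0 < sin θ) (hμ : 0 < 1 - (2 - 2 * cos θ))
    (hb : b * cos ((t + 1 / 2) * θ) = 0)
    (hy : ((1 - (2 - 2 * cos θ)) ^ 2 - p * (2 - 2 * cos θ)) * y = 0)
    (hbr : sin θ * (b * sin ((t + 1 / 2) * θ)) + (1 - (2 - 2 * cos θ)) * y = 0) :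
    b = 0 ∧ y = 0 := by
  have hts' : (t : ℝ) ≤ s := by exact_mod_cast hts
  have ht0 : (0 : ℝ) ≤ t := by positivity
  have hle : (t + 1 / 2) * θ ≤ π / 2 := by nlinarith
  have hpos : 0 < (t + 1 / 2) * θ := by positivity
  have hsB : 0 < sin ((t + 1 / 2) * θ) := sin_pos_of_pos_of_lt_pi hpos (by linarith [pi_pos])
  rcases hle.lt_or_eq with hlt | heq
  · have hc : cos ((t + 1 / 2) * θ) ≠ 0 :=
      (cos_pos_of_mem_Ioo ⟨by linarith [pi_pos], hlt⟩).ne'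
    obtain rfl := (mul_eq_zero.1 hb).resolve_right hc
    refine ⟨rfl, ?_⟩
    rw [zero_mul, mul_zero, zero_add] at hbr
    exact (mul_eq_zero.1 hbr).resolve_left hμ.ne'
  · -- both arms vanish at the branching vertex: the symmetric case `s = t`
    have hst : t = s := by
      have : (s : ℝ) ≤ t := by
        by_contra hcon
        push Not at hcon
        nlinarith
      exact le_antisymm hts (by exact_mod_cast this)
    subst hst
    have hK := star_factor_ne_zero hs p (θ := θ) (by linarith)
    obtain rfl := (mul_eq_zero.1 hy).resolve_left hK
    refine ⟨?_, rfl⟩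
    rw [mul_zero, add_zero] at hbr
    exact (mul_eq_zero.1 ((mul_eq_zero.1 hbr).resolve_left hsin.ne')).resolve_right hsB.ne'

lemma isFiedlerVector_iff {V : Type*} [Fintype V] [DecidableEq V]
    (G : SimpleGraph V) [DecidableRel G.Adj] (Φ : V → ℝ) :
    IsFiedlerVector G Φ ↔ ∃ μ, IsFirstNonzeroLaplacianEigenvalue G μ ∧ Φ ≠ 0 ∧
      G.lapMatrix ℝ *ᵥ Φ = μ • Φ := by
  simp only [IsFiedlerVector, Module.End.hasEigenvector_iff, Module.End.mem_eigenspace_iff,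
    Matrix.toLin'_apply]
  exact exists_congr fun μ => and_congr_right fun _ => and_comm

lemma exists_isFiedlerVector (s t p : ℕ) : ∃ Φ, IsFiedlerVector (roseTree s t p) Φ := by
  obtain ⟨μ, hμ⟩ := exists_isFirstNonzeroLaplacianEigenvalue (roseTree s t p)
    (roseTree_adj_inl_none.2 rfl : (roseTree s t p).Adj (.inl ⟨s, by omega⟩) (.inr none))
  obtain ⟨f, hf, h⟩ := (hasEigenvalue_iff_exists_mulVec _ _).1 hμ.1.2
  exact ⟨f, (isFiedlerVector_iff _ _).2 ⟨μ, hμ, hf, h⟩⟩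

lemma cos_half_pos {θ : ℝ} (h0 : 0 < θ) (h4 : θ < π / 4) : 0 < cos (θ / 2) :=
  cos_pos_of_mem_Ioo ⟨by linarith [pi_pos], by linarith [pi_pos]⟩

/-- An eigenvector for the first nonzero eigenvalue is determined by its value at the end of the
longer arm. -/
lemma exists_determining_vertex {s t : ℕ} (p : ℕ) (hs : 3 ≤ s) (ht : 3 ≤ t) {θ : ℝ} (h0 : 0 < θ)
    (hθ : (s + t + 1) * θ ≤ π) :
    ∃ v, ∀ f, (roseTree s t p).lapMatrix ℝ *ᵥ f = (2 - 2 * cos θ) • f → f v = 0 → f = 0 := by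
  obtain ⟨hμ0, hμ1, h4⟩ := eigenvalue_lt_of_mul_le_pi hs ht h0 hθ
  have hc := cos_half_pos h0 h4
  have hsin : 0 < sin θ := sin_pos_of_pos_of_lt_pi h0 (by linarith [pi_pos])
  rcases le_total t s with hts | hts
  · refine ⟨.inl ⟨0, by omega⟩, fun f hf hv => ?_⟩
    obtain ⟨a, b, y, h⟩ := exists_roseProfile hs ht h0 hθ hf
    rw [h.left_end] at hv
    obtain rfl := (mul_eq_zero.1 hv).resolve_right hc.ne'
    have hz := h.left_eq
    rw [zero_mul] at hz
    obtain ⟨rfl, rfl⟩ := amplitudes_eq_zero hs hts h0 hθ hsin (by linarith)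
      (h.right_eq.symm.trans hz) (h.star.symm.trans hz)
      (by have := h.branch.symm.trans hz; rwa [zero_mul, zero_add] at this)
    exact h.eq_zero
  · refine ⟨.inl ⟨s + t, by omega⟩, fun f hf hv => ?_⟩
    obtain ⟨a, b, y, h⟩ := exists_roseProfile hs ht h0 hθ hf
    rw [h.right_end] at hv
    obtain rfl := (mul_eq_zero.1 hv).resolve_right hc.ne'
    have hz := h.right_eq
    rw [zero_mul] at hz
    obtain ⟨rfl, rfl⟩ := amplitudes_eq_zero ht hts h0 (by linarith) hsin (by linarith)
      (h.left_eq.symm.trans hz) (h.star.symm.trans hz)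
      (by have := h.branch.symm.trans hz; rwa [zero_mul, add_zero] at this)
    exact h.eq_zero

lemma roseTree_hasUniqueFiedlerVector {s t : ℕ} (p : ℕ) (hs : 3 ≤ s) (ht : 3 ≤ t) :
    HasUniqueFiedlerVector (roseTree s t p) := by
  obtain ⟨Φ, hΦ⟩ := exists_isFiedlerVector s t p
  refine ⟨Φ, hΦ, fun Ψ hΨ => ?_⟩
  obtain ⟨μ, hμ, hΦ0, hLΦ⟩ := (isFiedlerVector_iff _ _).1 hΦ
  obtain ⟨μ', hμ', hΨ0, hLΨ⟩ := (isFiedlerVector_iff _ _).1 hΨ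
  obtain rfl := IsLeast.unique hμ hμ'
  obtain ⟨θ, h0, hθ, rfl⟩ := exists_angle hs hμ
  obtain ⟨v, hv⟩ := exists_determining_vertex p hs ht h0 hθ
  have hΦv : Φ v ≠ 0 := fun h => hΦ0 (hv Φ hLΦ h)
  have hΨv : Ψ v ≠ 0 := fun h => hΨ0 (hv Ψ hLΨ h)
  refine ⟨Ψ v / Φ v, div_ne_zero hΨv hΦv, sub_eq_zero.1 (hv _ ?_ ?_)⟩
  · rw [mulVec_sub, mulVec_smul, hLΦ, hLΨ, smul_sub, smul_comm]
  · simp [hΦv]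

/-! ### At most one leaf -/

/-- With positive star factor, the two ends of the path have opposite signs. -/
lemma RoseProfile.amplitudes_mul_neg {s t p : ℕ} (hs : 3 ≤ s) (ht : 3 ≤ t) {θ a b y : ℝ} (h0 : 0 < θ)
    (hθ : (s + t + 1) * θ ≤ π) {f : RoseVertex s t p → ℝ} (h : RoseProfile s t p θ f a b y)
    (hf : f ≠ 0) (hK : 0 < (1 - (2 - 2 * cos θ)) ^ 2 - p * (2 - 2 * cos θ)) : a * b < 0 := by
  obtain ⟨hμ0, hμ1, h4⟩ := eigenvalue_lt_of_mul_le_pi hs ht h0 hθ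
  have hsin : 0 < sin θ := sin_pos_of_pos_of_lt_pi h0 (by linarith [pi_pos])
  have hsAB : 0 ≤ sin ((s + t + 1) * θ) := sin_nonneg_of_nonneg_of_le_pi (by positivity) hθ
  have hsq := h.sq_branch
  have hst := h.star
  have hbr := h.branch
  set v := f (.inl ⟨s, by omega⟩)
  set K := (1 - (2 - 2 * cos θ)) ^ 2 - p * (2 - 2 * cos θ) with hKdef
  set μ := 2 - 2 * cos θ
  by_cases hy : y = 0
  · rw [hy, mul_zero] at hst
    rw [hst, hy, mul_zero, add_zero] at hbr
    have hs0 : (0 : ℝ) ≤ s := by positivity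
    have ht0 : (0 : ℝ) ≤ t := by positivity
    have hsA : 0 < sin ((s + 1 / 2) * θ) :=
      sin_pos_of_pos_of_lt_pi (by positivity) (by nlinarith)
    have hsB : 0 < sin ((t + 1 / 2) * θ) :=
      sin_pos_of_pos_of_lt_pi (by positivity) (by nlinarith)
    have hab : a * sin ((s + 1 / 2) * θ) + b * sin ((t + 1 / 2) * θ) = 0 :=
      (mul_eq_zero.1 hbr.symm).resolve_left hsin.ne'
    have ha : a ≠ 0 := by
      rintro rfl
      rw [zero_mul, zero_add] at hab
      obtain rfl := (mul_eq_zero.1 hab).resolve_right hsB.ne'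
      subst hy
      exact hf h.eq_zero
    have h1 : a * b * sin ((t + 1 / 2) * θ) = -(a ^ 2 * sin ((s + 1 / 2) * θ)) := by
      linear_combination a * hab
    have h2 : 0 < a ^ 2 * sin ((s + 1 / 2) * θ) := by positivity
    by_contra hcon
    have := mul_nonneg (not_lt.1 hcon) hsB.le
    linarith
  · -- `K < 1 - μ`, so the branch equation makes `a b sin ((s + t + 1) θ)` negative
    have hK1 : K < 1 - μ := by
      have : 0 ≤ p * μ := by positivity
      nlinarith
    have hy2 : 0 < y ^ 2 := by positivity
    have hneg : sin θ * (a * b) * sin ((s + t + 1) * θ) < 0 := by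
      have : sin θ * (a * b) * sin ((s + t + 1) * θ) = K * (K - (1 - μ)) * y ^ 2 := by
        rw [hst] at hsq; linear_combination -hsq
      rw [this]
      exact mul_neg_of_neg_of_pos (mul_neg_of_pos_of_neg hK (by linarith)) hy2
    by_contra hcon
    have := mul_nonneg (mul_nonneg hsin.le (not_lt.1 hcon)) hsAB
    linarith

/-- A star with at most one leaf is a shorter arm than an arm of length at least `3`, and its tip
carries a smaller value: `(1 - 3 μ + μ ^ 2) cos (θ / 2) = cos (5 θ / 2)`. -/
lemma star_tip_lt {s p : ℕ} (hs : 3 ≤ s) (hp : p ≤ 1) {θ a y : ℝ} (h0 : 0 < θ)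
    (hc : 0 < cos (θ / 2)) (hA : (s + 1 / 2) * θ ≤ π) (hμ : 0 < 2 - 2 * cos θ) (ha : 0 < a)
    (hK : 0 < (1 - (2 - 2 * cos θ)) ^ 2 - p * (2 - 2 * cos θ))
    (h : ((1 - (2 - 2 * cos θ)) ^ 2 - p * (2 - 2 * cos θ)) * y = a * cos ((s + 1 / 2) * θ)) :
    y < a * cos (θ / 2) := by
  have hs' : (3 : ℝ) ≤ s := by exact_mod_cast hs
  have hp' : (p : ℝ) ≤ 1 := by exact_mod_cast hp
  have h5 : cos (5 * θ / 2) = ((1 - (2 - 2 * cos θ)) ^ 2 - (2 - 2 * cos θ)) * cos (θ / 2) := by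
    have e1 : cos θ = 2 * cos (θ / 2) ^ 2 - 1 := by rw [← cos_two_mul]; congr 1; ring
    have e2 : sin θ = 2 * sin (θ / 2) * cos (θ / 2) := by rw [← sin_two_mul]; congr 1; ring
    have e3 := sin_sq_add_cos_sq (θ / 2)
    rw [show 5 * θ / 2 = θ / 2 + 2 * θ by ring, cos_add, cos_two_mul, sin_two_mul, e2, e1]
    linear_combination (-4 * cos (θ / 2) * (2 * cos (θ / 2) ^ 2 - 1)) * e3
  have hlt : cos ((s + 1 / 2) * θ) < cos (5 * θ / 2) :=
    cos_lt_cos_of_nonneg_of_le_pi (by positivity) hA (by nlinarith)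
  have hKge : ((1 - (2 - 2 * cos θ)) ^ 2 - (2 - 2 * cos θ)) * cos (θ / 2) ≤
      ((1 - (2 - 2 * cos θ)) ^ 2 - p * (2 - 2 * cos θ)) * cos (θ / 2) := by
    gcongr; nlinarith
  refine lt_of_mul_lt_mul_left ?_ hK.le
  rw [h]
  calc a * cos ((s + 1 / 2) * θ) < a * cos (5 * θ / 2) := by gcongr
    _ ≤ a * (((1 - (2 - 2 * cos θ)) ^ 2 - p * (2 - 2 * cos θ)) * cos (θ / 2)) := by
      gcongr; rw [h5]; exact hKge
    _ = _ := by ring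

/-- With at most one leaf, a profile that is positive on the left arm's end and negative on the
right arm's end is extremal exactly at these two ends. -/
lemma RoseProfile.strict_extrema {s t p : ℕ} (hs : 3 ≤ s) (ht : 3 ≤ t) (hp : p ≤ 1) {θ a b y : ℝ}
    (h0 : 0 < θ) (hθ : (s + t + 1) * θ ≤ π) {f : RoseVertex s t p → ℝ}
    (h : RoseProfile s t p θ f a b y) (ha : 0 < a) (hb : b < 0)
    (hK : 0 < (1 - (2 - 2 * cos θ)) ^ 2 - p * (2 - 2 * cos θ)) (v : RoseVertex s t p) :
    (v ≠ .inl ⟨0, by omega⟩ → f v < f (.inl ⟨0, by omega⟩)) ∧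
    (v ≠ .inl ⟨s + t, by omega⟩ → f (.inl ⟨s + t, by omega⟩) < f v) := by
  obtain ⟨hμ0, hμ1, h4⟩ := eigenvalue_lt_of_mul_le_pi hs ht h0 hθ
  have hc := cos_half_pos h0 h4
  have hs' : (3 : ℝ) ≤ s := by exact_mod_cast hs
  have ht' : (3 : ℝ) ≤ t := by exact_mod_cast ht
  have hA : (s + 1 / 2) * θ ≤ π := by nlinarith
  have hB : (t + 1 / 2) * θ ≤ π := by nlinarith
  -- the value at the branching vertex bounds each arm on the side away from its end
  have hcle : ∀ {j m : ℕ}, j ≤ m → (m + 1 / 2) * θ ≤ π →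
      cos ((m + 1 / 2) * θ) ≤ cos ((j + 1 / 2) * θ) := fun {j m} hjm hm => by
    have : (j : ℝ) ≤ m := by exact_mod_cast hjm
    exact cos_le_cos_of_nonneg_of_le_pi (by positivity) hm (by gcongr)
  have hclt : ∀ {j m : ℕ}, j ≤ m → 0 < j → (m + 1 / 2) * θ ≤ π →
      cos ((j + 1 / 2) * θ) < cos (θ / 2) := fun {j m} hjm hj hm => by
    have h1 : (j : ℝ) ≤ m := by exact_mod_cast hjm
    have h2 : (0 : ℝ) < j := by exact_mod_cast hj
    exact cos_lt_cos_of_nonneg_of_le_pi (by positivity) (by nlinarith) (by nlinarith)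
  have hsA := h.left_eq
  have hsB := h.right_eq
  have hvA : f (.inl ⟨s, by omega⟩) < a * cos (θ / 2) := by
    rw [hsA]; exact mul_lt_mul_of_pos_left (hclt le_rfl (by omega) hA) ha
  have hvB : b * cos (θ / 2) < f (.inl ⟨s, by omega⟩) := by
    rw [hsB]; exact mul_lt_mul_of_neg_left (hclt le_rfl (by omega) hB) hb
  have hac : 0 < a * cos (θ / 2) := by positivity
  have hbc : b * cos (θ / 2) < 0 := mul_neg_of_neg_of_pos hb hc
  have hyA : y < a * cos (θ / 2) :=
    star_tip_lt hs hp h0 hc hA hμ0 ha hK (h.star.symm.trans hsA)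
  have hyB : b * cos (θ / 2) < y := by
    have := star_tip_lt (y := -y) ht hp h0 hc hB hμ0 (neg_pos.2 hb) hK
      (by linarith [h.star.symm.trans hsB])
    linarith
  rw [h.left_end, h.right_end]
  rcases v with ⟨j, hj⟩ | _ | k
  · rcases le_total j s with hjs | hjs
    · rw [h.left j hj hjs]
      constructor
      · intro hne
        have : 0 < j := Nat.pos_of_ne_zero fun h => hne (by subst h; rfl)
        exact mul_lt_mul_of_pos_left (hclt hjs this hA) ha
      · intro _
        refine hvB.trans_le ?_
        rw [hsA]
        exact mul_le_mul_of_nonneg_left (hcle hjs hA) ha.le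
    · obtain ⟨d, rfl⟩ := Nat.exists_eq_add_of_le hjs
      have h1 := h.right (t - d) (by omega)
      have e : s + t - (t - d) = s + d := by omega
      simp only [e] at h1
      rw [h1]
      constructor
      · intro _
        refine lt_of_le_of_lt ?_ hvA
        rw [hsB]
        exact mul_le_mul_of_nonpos_left (hcle (by omega) hB) hb.le
      · intro hne
        have : 0 < t - d := Nat.pos_of_ne_zero fun h => hne (by
          congr 2; omega)
        exact mul_lt_mul_of_neg_left (hclt (by omega) this hB) hb
  · rw [h.center]
    constructor
    · intro _
      rcases le_total y 0 with hy | hy <;> nlinarith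
    · intro _
      rcases le_total y 0 with hy | hy <;> nlinarith
  · rw [h.leaf]
    exact ⟨fun _ => hyA, fun _ => hyB⟩

lemma attains_of_strict {V : Type*} {Φ : V → ℝ} {m M : V} (hmM : m ≠ M)
    (hM : ∀ v, v ≠ M → Φ v < Φ M) (hm : ∀ v, v ≠ m → Φ m < Φ v) :
    {v : V | AttainsMinAt Φ v ∨ AttainsMaxAt Φ v}.ncard = 2 ∧
      (∀ v, AttainsMinAt Φ v → v = m) ∧ (∀ v, AttainsMaxAt Φ v → v = M) := by
  have h1 : ∀ v, AttainsMinAt Φ v → v = m := fun v hv => by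
    by_contra hne; exact (hm v hne).not_ge (hv m)
  have h2 : ∀ v, AttainsMaxAt Φ v → v = M := fun v hv => by
    by_contra hne; exact (hM v hne).not_ge (hv M)
  refine ⟨?_, h1, h2⟩
  have : {v : V | AttainsMinAt Φ v ∨ AttainsMaxAt Φ v} = {m, M} := by
    ext v
    simp only [Set.mem_ofPred_eq, Set.mem_insert_iff, Set.mem_singleton_iff]
    constructor
    · rintro (h | h)
      exacts [.inl (h1 v h), .inr (h2 v h)]
    · rintro (rfl | rfl)
      · exact .inl fun w => by
          by_cases hw : w = v
          · rw [hw]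
          · exact (hm w hw).le
      · exact .inr fun w => by
          by_cases hw : w = v
          · rw [hw]
          · exact (hM w hw).le
  rw [this, Set.ncard_pair hmM]

lemma roseTree_FED_of_le_one {s t p : ℕ} (hs : 3 ≤ s) (ht : 3 ≤ t) (hp : p ≤ 1) :
    FED (roseTree s t p) := by
  intro f hf
  obtain ⟨μ, hμ, hf0, hL⟩ := (isFiedlerVector_iff _ _).1 hf
  obtain ⟨θ, h0, hθ, rfl⟩ := exists_angle hs hμ
  obtain ⟨a, b, y, h⟩ := exists_roseProfile hs ht h0 hθ hL
  obtain ⟨hμ0, hμ1, h4⟩ := eigenvalue_lt_of_mul_le_pi hs ht h0 hθ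
  have hK : 0 < (1 - (2 - 2 * cos θ)) ^ 2 - p * (2 - 2 * cos θ) := by
    have hp' : (p : ℝ) ≤ 1 := by exact_mod_cast hp
    nlinarith
  have hab := h.amplitudes_mul_neg hs ht h0 hθ hf0 hK
  have hne : (.inl ⟨0, by omega⟩ : RoseVertex s t p) ≠ .inl ⟨s + t, by omega⟩ := by
    simp only [ne_eq, Sum.inl.injEq, Fin.mk.injEq]; omega
  rw [roseTree_diam p hs ht]
  rcases mul_neg_iff.1 hab with ⟨ha, hb⟩ | ⟨ha, hb⟩
  · have hx := h.strict_extrema hs ht hp h0 hθ ha hb hK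
    obtain ⟨h1, h2, h3⟩ := attains_of_strict hne.symm (fun v => (hx v).1) (fun v => (hx v).2)
    refine ⟨h1, fun m M hm hM => ?_⟩
    rw [h2 m hm, h3 M hM, SimpleGraph.dist_comm, roseTree_dist_ends]
  · have hx := h.neg.strict_extrema hs ht hp h0 hθ (neg_pos.2 ha) (neg_neg_iff_pos.2 hb) hK
    simp only [Pi.neg_apply, neg_lt_neg_iff] at hx
    obtain ⟨h1, h2, h3⟩ := attains_of_strict hne (fun v => (hx v).2) (fun v => (hx v).1)
    refine ⟨h1, fun m M hm hM => ?_⟩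
    rw [h2 m hm, h3 M hM, roseTree_dist_ends]

/-! ### Many leaves -/

/-- If the eigenvector of the left arm vanishes at the branching vertex, then the star factor is
nonnegative for the first eigenvalue `μ`: otherwise the vector with values `1 - μ` at the center,
`1` at the leaves and a multiple of that arm eigenvector on the left arm has mean zero and a
Rayleigh quotient smaller than `μ`. -/
lemma star_factor_nonneg {s t p : ℕ} (hs : 3 ≤ s) (ht : 3 ≤ t) {θ : ℝ} (h0 : 0 < θ)
    (hθ : (s + t + 1) * θ ≤ π)
    (hμ : IsFirstNonzeroLaplacianEigenvalue (roseTree s t p) (2 - 2 * cos θ))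
    (hA : (s + 1 / 2) * θ = π / 2) :
    0 ≤ (1 - (2 - 2 * cos θ)) ^ 2 - p * (2 - 2 * cos θ) := by
  obtain ⟨hμ0, hμ1, h4⟩ := eigenvalue_lt_of_mul_le_pi hs ht h0 hθ
  set c : ℕ → ℝ := fun j => if j ≤ s then cos ((j + 1 / 2) * θ) else 0 with hcdef
  set S : ℝ := ∑ j : Fin (s + t + 1), c j with hS
  have hcs : c s = 0 := by simp only [hcdef, le_refl, if_true]; rw [hA, cos_pi_div_two]
  have hSpos : 0 < S := by
    refine Finset.sum_pos' (fun j _ => ?_) ⟨⟨0, by omega⟩, Finset.mem_univ _, ?_⟩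
    · simp only [hcdef]
      split_ifs with hj
      · have hj' : ((j : ℕ) : ℝ) ≤ s := by exact_mod_cast hj
        have : (((j : ℕ) : ℝ) + 1 / 2) * θ ≤ (s + 1 / 2) * θ := by gcongr
        refine cos_nonneg_of_mem_Icc ⟨?_, by linarith⟩
        have : 0 ≤ (((j : ℕ) : ℝ) + 1 / 2) * θ := by positivity
        linarith [pi_pos]
      · exact le_rfl
    · simp only [hcdef, zero_le, if_true]
      refine cos_pos_of_mem_Ioo ⟨?_, ?_⟩ <;> push_cast <;> linarith [pi_pos]
  set μ := 2 - 2 * cos θ with hμdef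
  set β : ℝ := -((1 - μ) + p) / S with hβ
  have hβS : β * S = -((1 - μ) + p) := by rw [hβ]; field_simp
  set g : RoseVertex s t p → ℝ :=
    Sum.elim (fun i => β * c i) (fun o => o.elim (1 - μ) (fun _ => 1)) with hg
  have hgs : g (.inl ⟨s, by omega⟩) = 0 := by simp only [hg, Sum.elim_inl, hcs, mul_zero]
  have hgc : g (.inr none) = 1 - μ := rfl
  have hgl : ∀ k, g (.inr (some k)) = 1 := fun _ => rfl
  have hsum : ∑ v, g v = 0 := by
    rw [Fintype.sum_sum_type, Fintype.sum_option]
    simp only [hgc, hgl, Finset.sum_const, Finset.card_univ, Fintype.card_fin, nsmul_eq_mul]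
    have : ∑ i : Fin (s + t + 1), g (.inl i) = β * S := by
      rw [hS, Finset.mul_sum]; rfl
    rw [this, hβS]; ring
  have hmain := hμ.mul_dotProduct_le (roseTree_connected p) g hsum
  have hpath : ∀ j : Fin (s + t + 1),
      g (.inl j) * ((roseTree s t p).lapMatrix ℝ *ᵥ g) (.inl j) = μ * (g (.inl j) * g (.inl j)) := by
    intro j
    rcases lt_or_ge (j : ℕ) s with hj | hj
    · have hLj : ((roseTree s t p).lapMatrix ℝ *ᵥ g) (.inl j) = μ * g (.inl j) := by
        rw [roseTree_lapMatrix_inl g (fun j => β * c j) (fun _ => rfl)]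
        obtain ⟨j, hjn⟩ := j
        change j < s at hj
        simp only
        rw [if_neg (by omega : ¬ j = s), if_pos (by omega : j + 1 < s + t + 1), add_zero]
        change _ = μ * (β * c j)
        have c1 : c j = cos ((j + 1 / 2) * θ) := if_pos hj.le
        have c2 : c (j + 1) = cos ((j + 1 / 2) * θ + θ) := by
          simp only [hcdef]; rw [if_pos (by omega)]; congr 1; push_cast; ring
        rcases j with _ | j
        · rw [if_neg (lt_irrefl _), zero_add]
          have e : cos (((0 : ℕ) + 1 / 2 : ℝ) * θ) = cos (((0 : ℕ) + 1 / 2 : ℝ) * θ - θ) := by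
            rw [← cos_neg]; congr 1; push_cast; ring
          rw [cos_sub] at e
          rw [c1, c2, cos_add]
          linear_combination -β * e
        · rw [if_pos (by omega)]
          have c3 : c (j + 1 - 1) = cos (((j + 1 : ℕ) + 1 / 2 : ℝ) * θ - θ) := by
            simp only [hcdef, Nat.add_sub_cancel]
            rw [if_pos (by omega)]; congr 1; push_cast; ring
          rw [c1, c2, c3, cos_add, cos_sub]; ring
      rw [hLj]; ring
    · have : g (.inl j) = 0 := by
        rcases hj.eq_or_lt with h | h
        · simp only [hg, Sum.elim_inl, ← h, hcs, mul_zero]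
        · simp only [hg, Sum.elim_inl, hcdef]
          rw [if_neg (by omega), mul_zero]
      rw [this]; ring
  rw [dotProduct, dotProduct, Fintype.sum_sum_type, Fintype.sum_sum_type, Fintype.sum_option,
    Fintype.sum_option, mul_add, Finset.mul_sum, Finset.sum_congr rfl fun j _ => hpath j,
    add_le_add_iff_left, roseTree_lapMatrix_center] at hmain
  simp only [roseTree_lapMatrix_leaf, hgs, hgc, hgl, Finset.sum_const, Finset.card_univ,
    Fintype.card_fin, nsmul_eq_mul] at hmain
  have h1 : 0 ≤ (1 - μ) * ((1 - μ) ^ 2 - p * μ) := by linarith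
  exact nonneg_of_mul_nonneg_right h1 (by linarith)

/-- For large `p`, extrema at the two ends of the path would make the star factor negative and the
eigenvector vanish at the branching vertex, against `star_factor_nonneg`. -/
lemma exists_forall_lt_not_FED {s t : ℕ} (hs : 3 ≤ s) (ht : 3 ≤ t) :
    ∃ P : ℕ, ∀ p, P < p → ¬ FED (roseTree s t p) := by
  have hs0 : (3 : ℝ) ≤ s := by exact_mod_cast hs
  have ht0 : (3 : ℝ) ≤ t := by exact_mod_cast ht
  -- below this angle, both arms are too short for a sign change
  set θ₁ : ℝ := π / (2 * (s + t) + 1) with hθ₁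
  have hθ₁pos : 0 < θ₁ := by positivity
  have hθ₁pi : θ₁ ≤ π := div_le_self pi_pos.le (by linarith)
  have hμ₁ : 0 < 2 - 2 * cos θ₁ := by
    have := cos_lt_cos_of_nonneg_of_le_pi le_rfl hθ₁pi hθ₁pos
    rw [cos_zero] at this; linarith
  obtain ⟨P, hP⟩ := exists_nat_gt (1 / (2 - 2 * cos θ₁))
  refine ⟨P, fun p hp hFED => ?_⟩
  obtain ⟨f, hf⟩ := exists_isFiedlerVector s t p
  obtain ⟨-, hdist⟩ := hFED f hf
  obtain ⟨μ, hμ, hf0, hL⟩ := (isFiedlerVector_iff _ _).1 hf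
  have hsum := sum_eq_zero_of_lapMatrix_mulVec_eq_smul _ hμ.1.1.ne' hL
  obtain ⟨θ, h0, hθ, rfl⟩ := exists_angle hs hμ
  obtain ⟨a, b, y, h⟩ := exists_roseProfile hs ht h0 hθ hL
  obtain ⟨hμ0, hμ1, h4⟩ := eigenvalue_lt_of_mul_le_pi hs ht h0 hθ
  have hc := cos_half_pos h0 h4
  have : Nonempty (RoseVertex s t p) := ⟨.inr none⟩
  obtain ⟨m, hm⟩ := Finite.exists_min f
  obtain ⟨M, hM⟩ := Finite.exists_max f
  obtain ⟨v, hv⟩ : ∃ v, f v ≠ 0 := by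
    by_contra hcon; push Not at hcon; exact hf0 (funext hcon)
  have hm0 : f m < 0 := by
    by_contra hcon
    have := (Finset.sum_eq_zero_iff_of_nonneg
      fun v _ => (not_lt.1 hcon).trans (hm v)).1 hsum v (Finset.mem_univ v)
    exact hv this
  have hM0 : 0 < f M := by
    by_contra hcon
    have := (Finset.sum_eq_zero_iff_of_nonpos
      fun v _ => (hM v).trans (not_lt.1 hcon)).1 hsum v (Finset.mem_univ v)
    exact hv this
  have hends : f (.inl ⟨0, by omega⟩) * f (.inl ⟨s + t, by omega⟩) < 0 := by
    have h1 := hdist m M hm hM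
    rw [roseTree_diam p hs ht] at h1
    rcases not_not.1 (mt (roseTree_dist_lt p hs ht m M) (by omega)) with ⟨rfl, rfl⟩ | ⟨rfl, rfl⟩
    · exact mul_neg_of_neg_of_pos hm0 hM0
    · exact mul_neg_of_pos_of_neg hM0 hm0
  have hab : a * b < 0 := by
    rw [h.left_end, h.right_end] at hends
    have : a * cos (θ / 2) * (b * cos (θ / 2)) = a * b * cos (θ / 2) ^ 2 := by ring
    rw [this] at hends
    exact neg_of_mul_neg_left hends (by positivity)
  have hlarge : θ₁ ≤ θ := by
    by_contra hcon
    push Not at hcon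
    rw [hθ₁, lt_div_iff₀ (by positivity)] at hcon
    have hcA : 0 < cos ((s + 1 / 2) * θ) :=
      cos_pos_of_mem_Ioo ⟨by linarith [pi_pos, (by positivity : 0 < (s + 1 / 2) * θ)],
        by nlinarith⟩
    have hcB : 0 < cos ((t + 1 / 2) * θ) :=
      cos_pos_of_mem_Ioo ⟨by linarith [pi_pos, (by positivity : 0 < (t + 1 / 2) * θ)],
        by nlinarith⟩
    have e : f (.inl ⟨s, by omega⟩) ^ 2 =
        a * b * (cos ((s + 1 / 2) * θ) * cos ((t + 1 / 2) * θ)) := by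
      rw [sq]; nth_rewrite 1 [h.left_eq]; rw [h.right_eq]; ring
    have : a * b * (cos ((s + 1 / 2) * θ) * cos ((t + 1 / 2) * θ)) < 0 :=
      mul_neg_of_neg_of_pos hab (by positivity)
    nlinarith [sq_nonneg (f (.inl ⟨s, by omega⟩))]
  have hK : (1 - (2 - 2 * cos θ)) ^ 2 - p * (2 - 2 * cos θ) < 0 := by
    have h1 : cos θ ≤ cos θ₁ := cos_le_cos_of_nonneg_of_le_pi hθ₁pos.le (by linarith) hlarge
    have h2 : (P : ℝ) < p := by exact_mod_cast hp
    have h3 : 1 < p * (2 - 2 * cos θ₁) := by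
      rw [div_lt_iff₀ hμ₁] at hP; nlinarith
    have h5 : (p : ℝ) * (2 - 2 * cos θ₁) ≤ p * (2 - 2 * cos θ) := by gcongr
    nlinarith
  -- both terms on the right of the branch equation are nonpositive
  have hsin : 0 < sin θ := sin_pos_of_pos_of_lt_pi h0 (by linarith [pi_pos])
  have hsAB : 0 ≤ sin ((s + t + 1) * θ) := sin_nonneg_of_nonneg_of_le_pi (by positivity) hθ
  have hsq := h.sq_branch
  have h6 : sin θ * (a * b) * sin ((s + t + 1) * θ) ≤ 0 :=
    mul_nonpos_of_nonpos_of_nonneg (mul_nonpos_of_nonneg_of_nonpos hsin.le hab.le) hsAB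
  have h7 : (1 - (2 - 2 * cos θ)) * ((1 - (2 - 2 * cos θ)) ^ 2 - p * (2 - 2 * cos θ)) * y ^ 2 ≤
      0 :=
    mul_nonpos_of_nonpos_of_nonneg
      (mul_nonpos_of_nonneg_of_nonpos (by linarith) hK.le) (sq_nonneg y)
  have hv0 : f (.inl ⟨s, by omega⟩) = 0 := by
    have : f (.inl ⟨s, by omega⟩) ^ 2 = 0 := le_antisymm (by linarith) (sq_nonneg _)
    exact pow_eq_zero_iff two_ne_zero |>.1 this
  have ha : a ≠ 0 := fun ha => by rw [ha, zero_mul] at hab; exact lt_irrefl _ hab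
  have hcA : cos ((s + 1 / 2) * θ) = 0 :=
    (mul_eq_zero.1 (h.left_eq.symm.trans hv0)).resolve_left ha
  have hA : (s + 1 / 2) * θ = π / 2 := by
    refine injOn_cos ⟨by positivity, by nlinarith⟩ ⟨by positivity, by linarith [pi_pos]⟩ ?_
    rw [hcA, cos_pi_div_two]
  exact (star_factor_nonneg hs ht h0 hθ hμ hA).not_gt hK

/-! ### The thresholds -/

/-- Thresholds for a property of natural numbers that holds at `0` and `1` and fails eventually. -/
lemma exists_thresholds {Q : ℕ → Prop} (h01 : ∀ p ≤ 1, Q p) (hfail : ∃ P, ∀ p, P < p → ¬ Q p) :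
    ∃ l u : ℕ, 1 ≤ l ∧ (∀ p ≤ l, Q p) ∧ (∀ p, u < p → ¬ Q p) ∧ ¬ Q (l + 1) ∧ Q u := by
  classical
  obtain ⟨P, hP⟩ := hfail
  have hex : ∃ p, ¬ Q p := ⟨P + 1, hP _ P.lt_succ_self⟩
  have h2 : 2 ≤ Nat.find hex := by
    by_contra hcon
    exact Nat.find_spec hex (h01 _ (by omega))
  refine ⟨Nat.find hex - 1, Nat.findGreatest Q P, by omega, fun p hp => ?_, fun p hp hQ => ?_, ?_,
    Nat.findGreatest_spec (Nat.zero_le P) (h01 0 zero_le_one)⟩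
  · exact not_not.1 (Nat.find_min hex (by omega))
  · rcases le_or_gt p P with hpP | hpP
    · exact Nat.findGreatest_is_greatest hp hpP hQ
    · exact hP p hpP hQ
  · rw [Nat.sub_add_cancel (by omega)]
    exact Nat.find_spec hex

theorem theorem1 :
    (∀ s t p : ℕ, 3 ≤ s → 3 ≤ t → HasUniqueFiedlerVector (roseTree s t p)) ∧
    ∃ f_m f_M : ℕ → ℕ → ℝ, ∀ s t : ℕ, 3 ≤ s → 3 ≤ t →
      -- the range `p ≤ f_m` is not empty
      1 ≤ f_m s t ∧
      -- below `f_m`, and above `f_M`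
      (∀ p : ℕ, (p : ℝ) ≤ f_m s t → FED (roseTree s t p)) ∧
      (∀ p : ℕ, f_M s t < (p : ℝ) → ¬ FED (roseTree s t p)) ∧
      -- neither threshold can be moved past the next integer
      ¬ FED (roseTree s t (⌊f_m s t⌋₊ + 1)) ∧
      FED (roseTree s t ⌊f_M s t⌋₊) := by
  refine ⟨fun s t p hs ht => roseTree_hasUniqueFiedlerVector p hs ht, ?_⟩
  have key : ∀ s t : ℕ, ∃ l u : ℕ, 3 ≤ s → 3 ≤ t → 1 ≤ l ∧ (∀ p ≤ l, FED (roseTree s t p)) ∧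
      (∀ p, u < p → ¬ FED (roseTree s t p)) ∧ ¬ FED (roseTree s t (l + 1)) ∧
      FED (roseTree s t u) := by
    intro s t
    by_cases h : 3 ≤ s ∧ 3 ≤ t
    · obtain ⟨l, u, hlu⟩ := exists_thresholds
        (fun p hp => roseTree_FED_of_le_one h.1 h.2 hp) (exists_forall_lt_not_FED h.1 h.2)
      exact ⟨l, u, fun _ _ => hlu⟩
    · exact ⟨0, 0, fun hs ht => absurd ⟨hs, ht⟩ h⟩
  choose l u hlu using key
  refine ⟨fun s t => l s t, fun s t => u s t, fun s t hs ht => ?_⟩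
  obtain ⟨h1, h2, h3, h4, h5⟩ := hlu s t hs ht
  simp only [Nat.cast_le, Nat.cast_lt]
  exact ⟨by exact_mod_cast h1, h2, h3, by rwa [Nat.floor_natCast], by rwa [Nat.floor_natCast]⟩
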